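/- For elements of a group put $[x,y]=x^{-1}y^{-1}xy$ and $[x_1,\dots,x_{k+1}]=[[x_1,\dots,x_k],x_{k+1}]$ for $k\ge 2$; let $\gamma_1(G)=G$, $\gamma_{n+1}(G)=[G,\gamma_n(G)]$ be the lower central series of a group $G$, and let $\langle w\rangle^G$ denote the normal closure of $w$ in $G$. A group $G$ is residually torsion-free nilpotent if for every $g\in G$ with $g\neq 1$ there is a normal subgroup $N$ of $G$ such that $g\notin N$ and $G/N$ is nilpotent and torsion-free. Theorem. Let $G=\langle a,t \mid [a,t,t]=[a,t,a,a,a]=1\rangle$. Then $G$ is not residually torsion-free nilpotent. Moreover, the element $w=[a,t,a,a,t,a]$ of $G$ satisfies $w\notin\gamma_7(G)$ (in particular $w\neq 1$), and for every $n\ge 1$ one has $w^2\in[\langle w\rangle^G,G]\,\gamma_n(G)$ and the order of $w$ modulo $\gamma_n(G)$ is a power of $2$ (that is, $w$ is a generalized $2$-torsion element). -/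

import Mathlib

namespace TwoCommutators

/-- The commutator `[x, y] = x⁻¹ y⁻¹ x y`. -/
def comm {G : Type*} [Group G] (x y : G) : G := x⁻¹ * y⁻¹ * x * y

/-- The left-normed commutator: `leftNormed x [y₁, …, yₖ]` is `[x, y₁, …, yₖ]`, that is
`[[…[[x, y₁], y₂], …], yₖ]`. -/
def leftNormed {G : Type*} [Group G] (x : G) (l : List G) : G := l.foldl comm x

/-- A group is residually torsion-free nilpotent if for each `g ≠ 1` there is a normal subgroup `N`
with `g ∉ N` such that `G ⧸ N` is nilpotent and has no nontrivial element of finite order. -/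
def IsResiduallyTorsionFreeNilpotent (G : Type*) [Group G] : Prop :=
  ∀ g : G, g ≠ 1 → ∃ (N : Subgroup G) (_ : N.Normal),
    g ∉ N ∧ Group.IsNilpotent (G ⧸ N) ∧ ∀ x : G ⧸ N, IsOfFinOrder x → x = 1

/-- `lcs G n` is the term `γₙ₊₁(G)` of the lower central series; thus `lcs G 0 = γ₁(G) = G`. -/
abbrev lcs (G : Type*) [Group G] (n : ℕ) : Subgroup G := (⊤ : Subgroup G).lowerCentralSeries n

/-- The relators `[a, t, t]` and `[a, t, a, a, a]` in the free group on `a` (index `0`) and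
`t` (index `1`). -/
def relators : Set (FreeGroup (Fin 2)) :=
  {leftNormed (FreeGroup.of 0) [FreeGroup.of 1, FreeGroup.of 1],
   leftNormed (FreeGroup.of 0) [FreeGroup.of 1, FreeGroup.of 0, FreeGroup.of 0, FreeGroup.of 0]}

/-- The group `⟨a, t | [a, t, t] = [a, t, a, a, a] = 1⟩`. -/
abbrev D : Type := PresentedGroup relators

/-- The generator `a` of `D`. -/
def a : D := PresentedGroup.of 0

/-- The generator `t` of `D`. -/
def t : D := PresentedGroup.of 1

/-- The element `w = [a, t, a, a, t, a]` of `D`. -/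
def w : D := leftNormed a [t, a, a, t, a]

end TwoCommutators

/-!
The relators say that `c = [a, t]` commutes with `t` and that `e = [a, t, a, a]` commutes with `a`.
Put `d = [c, a]` and `u = [e, t]`, so that `w = [u, a]`.

*Why `w² ∈ [⟨w⟩^D, D]`.* The claim is that `w² = 1` as soon as `w` is central
(`sq_eq_one_of_central`). In the associated Lie ring this is the computation
`[e, t, a] = [e, a, t] + [e, [t, a]] = -[e, c]` on the one hand and, since `[e, t] = [d, c]`,
`[e, t, a] = [d, c, a] = [e, c]` on the other. In the group, conjugation by `e`, applied to
`[c, t] = 1`, shows that `u` commutes with `c`, hence (conjugating by `a`) with `d` and `e`, and that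
`[c, e] = w`. Conjugating `[c, t] = 1` by `a` twice gives `[d, c] = u w²`. Conjugating this last
equation by `a` once more turns the left side into `[de, cd] = [d, c] w⁻¹` and the right side into
`u w³`, so `w² = 1`.

*Why this makes `w` a generalized `2`-torsion element.* If `K` is normal and `K / [K, G]` has
exponent `p`, then so has every factor of the series `K, [K, G], [K, G, G], …`, because
`[x ^ p, g] = [x, g] ^ p` modulo the next term. This series lies below the lower central series,
so `w ^ 2 ^ n ∈ lcs D n` (`pow_pow_mem_lcs`). Thus `w` has `2`-power order modulo each `lcs D n`, and
every torsion-free nilpotent quotient kills it.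

*Why `w ∉ γ₇`.* The group `D` maps to the unitriangular `7 × 7` matrices over `𝔽₂`, a group of
class `6`, in such a way that `w` goes to the nontrivial central element `1 + E₀₆` (`rep`,
`w_notMem_lcs`).
-/

namespace TwoCommutators

/-! ### Commutators and the central case -/

section Identity

variable {G : Type*} [Group G]

theorem comm_eq_one_iff {x y : G} : comm x y = 1 ↔ Commute x y := by
  unfold comm Commute SemiconjBy
  constructor
  · intro h
    have : x * y = y * x * (x⁻¹ * y⁻¹ * x * y) := by group
    rw [this, h, mul_one]
  · intro h
    rw [mul_assoc _ x y, h]; group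

theorem mul_eq_mul_comm (x y : G) : x * y = y * (x * comm x y) := by
  unfold comm; group

theorem map_comm {H : Type*} [Group H] (f : G →* H) (x y : G) :
    f (comm x y) = comm (f x) (f y) := by
  simp [comm]

theorem map_leftNormed {H : Type*} [Group H] (f : G →* H) (x : G) (l : List G) :
    f (leftNormed x l) = leftNormed (f x) (l.map f) := by
  induction l generalizing x with
  | nil => rfl
  | cons y l ih => simpa [leftNormed, map_comm] using ih (comm x y)

/-- In any group where `a` and `t` satisfy the two relations, if `[a, t, a, a, t, a]` is central then
its square is trivial. -/
theorem sq_eq_one_of_central {a t : G} (h₁ : leftNormed a [t, t] = 1)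
    (h₂ : leftNormed a [t, a, a, a] = 1)
    (hw : ∀ g, Commute (leftNormed a [t, a, a, t, a]) g) :
    leftNormed a [t, a, a, t, a] ^ 2 = 1 := by
  simp only [leftNormed, List.foldl] at *
  obtain ⟨c, hc⟩ : ∃ c, c = comm a t := ⟨_, rfl⟩
  obtain ⟨d, hd⟩ : ∃ d, d = comm c a := ⟨_, rfl⟩
  obtain ⟨e, he⟩ : ∃ e, e = comm d a := ⟨_, rfl⟩
  obtain ⟨u, hu⟩ : ∃ u, u = comm e t := ⟨_, rfl⟩
  obtain ⟨w, hw'⟩ : ∃ w, w = comm u a := ⟨_, rfl⟩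
  rw [← hc, ← hd, ← he] at h₂
  rw [← hc] at h₁
  rw [← hc, ← hd, ← he, ← hu, ← hw'] at hw ⊢
  rw [comm_eq_one_iff] at h₁ h₂
  -- the action of `a` and of `e` by conjugation
  let α : MulAut G := MulAut.conj a⁻¹
  let ε : MulAut G := MulAut.conj e⁻¹
  have αt : α t = t * c⁻¹ := by simp [α, hc, comm, mul_assoc]
  have αc : α c = c * d := by simp [α, hd, comm, mul_assoc]
  have αd : α d = d * e := by simp [α, he, comm, mul_assoc]
  have αu : α u = u * w := by simp [α, hw', comm, mul_assoc]
  have αw : α w = w := by simp [α, mul_assoc, (hw a).eq]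
  have εt : ε t = t * u⁻¹ := by simp [ε, hu, comm, mul_assoc]
  have εα (x : G) : ε (α x) = α (ε x) := by
    simp only [α, ε, MulAut.conj_apply, ← mul_assoc, inv_inv]
    rw [← mul_inv_rev, ← mul_inv_rev, h₂.eq, mul_assoc _ e a, mul_assoc _ a e, h₂.eq]
  have εc' : ε c = u * c * u⁻¹ * w := by
    have : c = (α t)⁻¹ * t := by rw [αt]; group
    have h := (hw (u * c * u⁻¹)).eq
    nth_rw 1 [this]
    rw [map_mul, map_inv, εα, εt, map_mul, map_inv, αt, αu]
    rw [← h]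
    simp only [mul_inv_rev, inv_inv, mul_assoc, inv_mul_cancel_left]
    rw [← mul_assoc, ← (hw u).eq]
    simp only [mul_assoc]
  -- conjugation by `e` preserves the relation between `c` and `t`
  have uc : Commute u c := by
    have h : Commute (ε c) (ε t) := h₁.map ε
    rw [εc', εt] at h
    have h' : Commute (u * c * u⁻¹) (t * u⁻¹) := by
      have := h.mul_left ((hw (t * u⁻¹)).inv_left)
      rwa [mul_inv_cancel_right] at this
    have h3 := h'.map (MulAut.conj u⁻¹)
    simp only [MulAut.conj_apply, inv_inv] at h3
    have h4 : Commute c (u⁻¹ * t) := by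
      convert h3 using 1 <;> group
    have h5 := h4.mul_right h₁.inv_right
    rw [mul_inv_cancel_right] at h5
    exact (Commute.inv_right_iff.1 h5).symm
  -- central factors can be dropped from a commutation relation
  have strip {x y : G} (h : Commute (x * w) y) : Commute x y := by
    have := h.mul_left (hw y).inv_left
    rwa [mul_inv_cancel_right] at this
  have ud : Commute u d := by
    have h := uc.map α
    rw [αu, αc] at h
    have := uc.inv_right.mul_right (strip h)
    rwa [inv_mul_cancel_left] at this
  have ue : Commute u e := by
    have h := ud.map α
    rw [αu, αd] at h
    have := ud.inv_right.mul_right (strip h)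
    rwa [inv_mul_cancel_left] at this
  have εc : ε c = c * w := by rw [εc', uc.eq, mul_inv_cancel_right]
  have ce : c * e = e * (c * w) := by
    rw [← εc]; simp [ε, mul_assoc]
  have de : Commute d e := by
    have h : ε d = d := by
      have : d = c⁻¹ * α c := by rw [αc]; group
      rw [this, map_mul, εα, map_inv, εc, map_mul, αw, αc, mul_inv_rev, ← (hw (c * d)).eq, mul_assoc,
        inv_mul_eq_iff_eq_mul,
        (hw c⁻¹).symm.left_comm, inv_mul_cancel_left]
    have : d * e = e * ε d := by simp [ε, mul_assoc]
    rwa [h] at this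
  -- conjugates by `a` of the relation `c * t = t * c`
  have tdc : t * (d * c) = c * (d * t) := by
    have h := (h₁.map α).eq
    rw [αc, αt] at h
    have : t * c⁻¹ * (c * d) * c = c * d * (t * c⁻¹) * c := by rw [h]
    simpa [mul_assoc] using this
  have et : e * t = t * (e * u) := by rw [mul_eq_mul_comm, hu]
  have left_comm {x y z : G} (h : x * y = z) (v : G) : x * (y * v) = z * v := by
    rw [← mul_assoc, h]
  have ec : c * e = w * e * c := by rw [ce, ← mul_assoc, ← (hw (e * c)).eq, mul_assoc]
  -- conjugating `t * (d * c) = c * (d * t)` by `a` and moving `t` to the left on both sides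
  have star : d * (c * (d * (c * e))) = c * (d * (d * (c * (e * (u * (w * w)))))) := by
    have h := congrArg α tdc
    simp only [map_mul, αt, αc, αd] at h
    have tc (x : G) : c * (t * (c⁻¹ * x)) = t * x := by
      rw [← mul_assoc c, h₁.eq, mul_assoc, mul_inv_cancel_left]
    have dt : d * t = c⁻¹ * (t * (d * c)) := by
      rw [tdc, inv_mul_cancel_left]
    have ddt : d * (d * t) = c⁻¹ * (t * (d * (d * c))) := by
      rw [dt, h₁.inv_left.left_comm, left_comm dt]
      simp only [mul_assoc, mul_inv_cancel_left]
    have ct : c * t = t * c := h₁.eq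
    apply mul_left_cancel (a := t)
    calc t * (d * (c * (d * (c * e))))
        = c * (t * c⁻¹ * (d * e * (c * d))) * c * (w * w) := by
          simp only [mul_assoc, tc, ec, left_comm ec, de.eq, left_comm de.eq, ← (hw c).eq,
            left_comm (hw c).eq.symm, left_comm (hw d).eq.symm, left_comm (hw e).eq.symm]
      _ = c * (c * d * (d * e * (t * c⁻¹))) * c * (w * w) := by rw [h]
      _ = c * (c * (d * (d * t))) * (e * (u * (w * w))) := by
          simp only [mul_assoc, inv_mul_cancel_left, left_comm et]
      _ = t * (c * (d * (d * (c * (e * (u * (w * w))))))) := by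
          rw [ddt]
          simp only [mul_assoc, mul_inv_cancel_left, left_comm ct]
  -- `[d, c] = u * w ^ 2`
  have dc : d * c = c * d * (u * (w * w)) := by
    apply mul_right_cancel (b := d * (c * e))
    simp only [mul_assoc, star, ue.eq, left_comm uc.eq, left_comm ud.eq, ← (hw u).eq,
      left_comm (hw c).eq.symm, left_comm (hw d).eq.symm, left_comm (hw e).eq.symm,
      left_comm (hw u).eq.symm]
  -- conjugating `[d, c] = u * w ^ 2` by `a` and collecting: the exponent of `w` is `2` on the left
  -- and `4` on the right
  have h := congrArg α dc
  simp only [map_mul, αc, αd, αu, αw, mul_assoc, left_comm ec, de.eq, left_comm de.eq,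
    left_comm dc, ud.eq, ← (hw u).eq, left_comm (hw c).eq.symm, left_comm (hw d).eq.symm,
    left_comm (hw e).eq.symm, left_comm (hw u).eq.symm, mul_right_inj] at h
  rw [← mul_assoc w w, eq_comm, mul_eq_right] at h
  rw [sq, h]

end Identity

/-! ### Exponents along the series `[K, G, …, G]` -/

section CommutatorSeries

open scoped commutatorElement

variable {G : Type*} [Group G]

theorem commutatorElement_pow_left {x g : G} (h : Commute ⁅x, g⁆ x) (n : ℕ) :
    ⁅x ^ n, g⁆ = ⁅x, g⁆ ^ n := by
  have hx : g * x * g⁻¹ = ⁅x, g⁆⁻¹ * x := by rw [commutatorElement_def]; group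
  have : ⁅x ^ n, g⁆ = x ^ n * ((g * x * g⁻¹) ^ n)⁻¹ := by
    rw [conj_pow, commutatorElement_def]; group
  rw [this, hx, h.inv_left.mul_pow, mul_inv_rev, mul_inv_cancel_left, inv_pow, inv_inv]

theorem commute_mk_of_mem {K : Subgroup G} [K.Normal] {x : G} (hx : x ∈ K) (g : G) :
    Commute (x : G ⧸ ⁅K, (⊤ : Subgroup G)⁆) g := by
  have h := Subgroup.commutator_mem_commutator hx (Subgroup.mem_top g)
  rw [← QuotientGroup.eq_one_iff] at h
  exact commutatorElement_eq_one_iff_commute.1 h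

/-- Since `K / [K, G]` is abelian, its exponent may be tested on generators of `K`. -/
theorem pow_mem_commutator_of_closure {K : Subgroup G} [K.Normal] {S : Set G}
    (hS : Subgroup.closure S = K) {p : ℕ} (h : ∀ s ∈ S, s ^ p ∈ ⁅K, (⊤ : Subgroup G)⁆)
    {x : G} (hx : x ∈ K) : x ^ p ∈ ⁅K, (⊤ : Subgroup G)⁆ := by
  rw [← hS] at hx
  induction hx using Subgroup.closure_induction with
  | mem s hs => exact h s hs
  | one => simp
  | inv x _ ih => simpa using ih
  | mul x y hx _ ihx ihy =>
    rw [hS] at hx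
    rw [← QuotientGroup.eq_one_iff] at ihx ihy ⊢
    rw [QuotientGroup.mk_pow, QuotientGroup.mk_mul, (commute_mk_of_mem hx y).mul_pow,
      ← QuotientGroup.mk_pow, ← QuotientGroup.mk_pow, ihx, ihy, one_mul]

/-- The series `K, [K, G], [K, G, G], …`. -/
def commSeries (K : Subgroup G) : ℕ → Subgroup G
  | 0 => K
  | n + 1 => ⁅commSeries K n, ⊤⁆

instance commSeries_normal (K : Subgroup G) [K.Normal] (n : ℕ) : (commSeries K n).Normal := by
  induction n with
  | zero => assumption
  | succ n _ => exact Subgroup.commutator_normal _ _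

theorem commSeries_le_lcs (K : Subgroup G) (n : ℕ) : commSeries K n ≤ lcs G n := by
  induction n with
  | zero => exact le_top
  | succ n ih => exact Subgroup.commutator_mono ih le_rfl

/-- If `K / [K, G]` has exponent dividing `p`, so has each further factor of `commSeries K`. -/
theorem pow_mem_commSeries_succ {K : Subgroup G} [K.Normal] {p : ℕ}
    (h : ∀ x ∈ K, x ^ p ∈ ⁅K, (⊤ : Subgroup G)⁆) (n : ℕ) :
    ∀ x ∈ commSeries K n, x ^ p ∈ commSeries K (n + 1) := by
  induction n with
  | zero => exact h
  | succ n ih =>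
    intro x hx
    refine pow_mem_commutator_of_closure (K := commSeries K (n + 1))
      (Subgroup.commutator_def _ _).symm ?_ hx
    rintro x ⟨y, hy, g, -, hx⟩
    have hyg : ⁅y, g⁆ ∈ commSeries K (n + 1) :=
      Subgroup.commutator_mem_commutator hy (Subgroup.mem_top g)
    -- modulo the next term, `⁅y, g⁆` is central, so `⁅y, g⁆ ^ p = ⁅y ^ p, g⁆`
    have hpow := Subgroup.commutator_mem_commutator (ih y hy) (Subgroup.mem_top g)
    rw [← QuotientGroup.eq_one_iff] at hpow ⊢
    have hc := commute_mk_of_mem hyg y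
    simp only [commutatorElement_def, QuotientGroup.mk_mul, QuotientGroup.mk_inv,
      QuotientGroup.mk_pow] at hpow hc
    simp only [← commutatorElement_def] at hpow hc
    rw [commutatorElement_pow_left hc] at hpow
    rw [← hx, ← hpow]
    simp [commutatorElement_def]

/-- A generalized `p`-torsion element has `p`-power order modulo every term of the lower central
series. -/
theorem pow_pow_mem_lcs {x : G} {p : ℕ}
    (h : x ^ p ∈ ⁅Subgroup.normalClosure {x}, (⊤ : Subgroup G)⁆) (n : ℕ) :
    x ^ p ^ n ∈ lcs G n := by
  refine commSeries_le_lcs (Subgroup.normalClosure {x}) n ?_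
  have hS : ∀ s ∈ Group.conjugatesOfSet {x},
      s ^ p ∈ ⁅Subgroup.normalClosure {x}, (⊤ : Subgroup G)⁆ := by
    intro s hs
    obtain ⟨y, hy, hs⟩ := Group.mem_conjugatesOfSet_iff.1 hs
    obtain ⟨g, rfl⟩ := isConj_iff.1 hs
    rw [Set.mem_singleton_iff.1 hy, conj_pow]
    exact Subgroup.Normal.conj_mem inferInstance _ h _
  have hK : ∀ y ∈ Subgroup.normalClosure {x},
      y ^ p ∈ ⁅Subgroup.normalClosure {x}, (⊤ : Subgroup G)⁆ := fun y hy =>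
    pow_mem_commutator_of_closure (K := Subgroup.normalClosure {x}) rfl hS hy
  induction n with
  | zero => simpa [commSeries] using Subgroup.subset_normalClosure (Set.mem_singleton x)
  | succ n ih =>
    rw [pow_succ, pow_mul]
    exact pow_mem_commSeries_succ hK n _ ih

end CommutatorSeries

/-! ### The filtration of the unitriangular group -/

section Unitriangular

open Matrix
open scoped commutatorElement

variable {R : Type*} [Ring R] {m : ℕ}

/-- The matrices supported on the entries `(i, j)` with `j ≥ i + k`. -/
def upperBand (R : Type*) [Ring R] (m k : ℕ) : AddSubgroup (Matrix (Fin m) (Fin m) R) where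
  carrier := {M | ∀ i j : Fin m, (j : ℕ) < i + k → M i j = 0}
  zero_mem' := by simp
  add_mem' hM hN i j h := by simp [hM i j h, hN i j h]
  neg_mem' hM i j h := by simp [hM i j h]

theorem mul_mem_upperBand {k l : ℕ} {M N : Matrix (Fin m) (Fin m) R}
    (hM : M ∈ upperBand R m k) (hN : N ∈ upperBand R m l) : M * N ∈ upperBand R m (k + l) := by
  intro i j h
  rw [mul_apply]
  refine Finset.sum_eq_zero fun x _ => ?_
  by_cases hx : (x : ℕ) < i + k
  · rw [hM i x hx, zero_mul]
  · rw [hN x j (by omega), mul_zero]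

theorem upperBand_antitone : Antitone (upperBand R m) :=
  fun _ _ hkl _ hM i j h => hM i j (by omega)

theorem one_mem_upperBand : (1 : Matrix (Fin m) (Fin m) R) ∈ upperBand R m 0 :=
  fun i j h => one_apply_ne (by rintro rfl; omega)

/-- The invertible matrices `g` such that `g` and `g⁻¹` are `1` up to `upperBand R m k`. For `k = 1`
this is the unitriangular group; for `k = 0` it is the group of units of the upper triangular
matrices. The condition on `g⁻¹` follows from the one on `g`, but stating it makes closure under
inverses immediate. -/
def unitriangular (R : Type*) [Ring R] (m k : ℕ) : Subgroup (Matrix (Fin m) (Fin m) R)ˣ where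
  carrier := {g | (g : Matrix (Fin m) (Fin m) R) - 1 ∈ upperBand R m k ∧
    ((g⁻¹ : (Matrix (Fin m) (Fin m) R)ˣ) : Matrix (Fin m) (Fin m) R) - 1 ∈ upperBand R m k}
  one_mem' := by simp
  mul_mem' := by
    have key {x y : Matrix (Fin m) (Fin m) R} (hx : x - 1 ∈ upperBand R m k)
        (hy : y - 1 ∈ upperBand R m k) : x * y - 1 ∈ upperBand R m k := by
      have : x * y - 1 = (x - 1) * (y - 1) + (x - 1) + (y - 1) := by noncomm_ring
      rw [this]
      exact add_mem (add_mem
        (upperBand_antitone (Nat.le_add_right k k) (mul_mem_upperBand hx hy)) hx) hy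
    rintro g h ⟨hg, hg'⟩ ⟨hh, hh'⟩
    exact ⟨by simpa using key hg hh, by simpa using key hh' hg'⟩
  inv_mem' := by
    rintro g ⟨hg, hg'⟩
    exact ⟨hg', by simpa using hg⟩

theorem mem_unitriangular_iff {k : ℕ} {g : (Matrix (Fin m) (Fin m) R)ˣ} :
    g ∈ unitriangular R m k ↔
      (∀ i j : Fin m, (j : ℕ) < i + k → g.val i j - (1 : Matrix (Fin m) (Fin m) R) i j = 0) ∧
      ∀ i j : Fin m, (j : ℕ) < i + k → g.inv i j - (1 : Matrix (Fin m) (Fin m) R) i j = 0 :=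
  Iff.rfl

theorem val_mem_upperBand {k : ℕ} {g : (Matrix (Fin m) (Fin m) R)ˣ}
    (hg : g ∈ unitriangular R m k) : (g : Matrix (Fin m) (Fin m) R) ∈ upperBand R m 0 := by
  simpa using add_mem (upperBand_antitone k.zero_le hg.1) one_mem_upperBand

theorem commutator_sub_one_mem {k l : ℕ} {g h : (Matrix (Fin m) (Fin m) R)ˣ}
    (hg : g ∈ unitriangular R m k) (hh : h ∈ unitriangular R m l) :
    ((⁅g, h⁆ : (Matrix (Fin m) (Fin m) R)ˣ) : Matrix (Fin m) (Fin m) R) - 1 ∈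
      upperBand R m (k + l) := by
  have : ((⁅g, h⁆ : (Matrix (Fin m) (Fin m) R)ˣ) : Matrix (Fin m) (Fin m) R) - 1 =
      ((g - 1 : Matrix (Fin m) (Fin m) R) * (h - 1) - (h - 1) * (g - 1)) *
        ((g⁻¹ * h⁻¹ : (Matrix (Fin m) (Fin m) R)ˣ) : Matrix (Fin m) (Fin m) R) := by
    have h1 : (1 : Matrix (Fin m) (Fin m) R) = ↑(h * g * (g⁻¹ * h⁻¹)) := by
      rw [← Units.val_one]; congr 1; group
    have h2 : ((⁅g, h⁆ : (Matrix (Fin m) (Fin m) R)ˣ) : Matrix (Fin m) (Fin m) R) =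
        ↑(g * h * (g⁻¹ * h⁻¹)) := by
      congr 1; rw [commutatorElement_def]; group
    rw [h2]
    nth_rw 1 [h1]
    rw [Units.val_mul, Units.val_mul (h * g), ← sub_mul]
    congr 1
    push_cast
    noncomm_ring
  rw [this]
  refine mul_mem_upperBand (l := 0) (sub_mem (mul_mem_upperBand hg.1 hh.1) ?_)
    (val_mem_upperBand (mul_mem (inv_mem (s := unitriangular R m 0) ?_) (inv_mem ?_)))
  · have := mul_mem_upperBand hh.1 hg.1
    rwa [add_comm l k] at this
  · exact ⟨upperBand_antitone k.zero_le hg.1, upperBand_antitone k.zero_le hg.2⟩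
  · exact ⟨upperBand_antitone l.zero_le hh.1, upperBand_antitone l.zero_le hh.2⟩

theorem commutator_unitriangular_le (k l : ℕ) :
    ⁅unitriangular R m k, unitriangular R m l⁆ ≤ unitriangular R m (k + l) := by
  rw [Subgroup.commutator_le]
  intro g hg h hh
  refine ⟨commutator_sub_one_mem hg hh, ?_⟩
  rw [commutatorElement_inv, add_comm k]
  exact commutator_sub_one_mem hh hg

/-- A homomorphism into the unitriangular group respects the two filtrations; the index shift is that
of `lcs`, which starts at `γ₁ = lcs G 0`. -/
theorem map_lcs_le_unitriangular {G : Type*} [Group G] {f : G →* (Matrix (Fin m) (Fin m) R)ˣ}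
    (hf : f.range ≤ unitriangular R m 1) (n : ℕ) :
    (lcs G n).map f ≤ unitriangular R m (n + 1) := by
  induction n with
  | zero => simpa [lcs, MonoidHom.range_eq_map] using hf
  | succ n ih =>
    rw [lcs, Subgroup.lowerCentralSeries_succ, Subgroup.map_commutator]
    refine (Subgroup.commutator_mono ih ?_).trans (commutator_unitriangular_le _ _)
    rwa [← MonoidHom.range_eq_map]

end Unitriangular

/-! ### A unitriangular representation over `𝔽₂` -/

section Representation

open Matrix

/-- Identifies a commutator of units from an equation without inverses. -/
theorem val_comm {R : Type*} [Monoid R] {x y : Rˣ} {X Y Z : R} (hx : x.val = X)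
    (hy : y.val = Y) (h : X * Y = Y * X * Z) : (comm x y).val = Z := by
  subst hx hy
  rw [comm, mul_assoc, Units.val_mul, Units.val_mul x, h, ← Units.val_mul y, ← mul_assoc,
    ← Units.val_mul]
  simp [mul_assoc]

/-- The image of `a` under `rep`. Its inverse is part of the data because the entries of both are
used to place it in the unitriangular group. -/
def matA : (Matrix (Fin 7) (Fin 7) (ZMod 2))ˣ where
  val :=
    !![1, 0, 0, 0, 0, 0, 0;
       0, 1, 1, 0, 0, 0, 0;
       0, 0, 1, 0, 1, 0, 0;
       0, 0, 0, 1, 1, 0, 0;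
       0, 0, 0, 0, 1, 1, 0;
       0, 0, 0, 0, 0, 1, 1;
       0, 0, 0, 0, 0, 0, 1]
  inv :=
    !![1, 0, 0, 0, 0, 0, 0;
       0, 1, 1, 0, 1, 1, 1;
       0, 0, 1, 0, 1, 1, 1;
       0, 0, 0, 1, 1, 1, 1;
       0, 0, 0, 0, 1, 1, 1;
       0, 0, 0, 0, 0, 1, 1;
       0, 0, 0, 0, 0, 0, 1]
  val_inv := by decide +kernel
  inv_val := by decide +kernel

/-- The image of `t` under `rep`. -/
def matT : (Matrix (Fin 7) (Fin 7) (ZMod 2))ˣ where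
  val :=
    !![1, 1, 0, 0, 0, 0, 0;
       0, 1, 0, 1, 0, 0, 0;
       0, 0, 1, 1, 0, 0, 0;
       0, 0, 0, 1, 0, 0, 0;
       0, 0, 0, 0, 1, 0, 0;
       0, 0, 0, 0, 0, 1, 0;
       0, 0, 0, 0, 0, 0, 1]
  inv :=
    !![1, 1, 0, 1, 0, 0, 0;
       0, 1, 0, 1, 0, 0, 0;
       0, 0, 1, 1, 0, 0, 0;
       0, 0, 0, 1, 0, 0, 0;
       0, 0, 0, 0, 1, 0, 0;
       0, 0, 0, 0, 0, 1, 0;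
       0, 0, 0, 0, 0, 0, 1]
  val_inv := by decide +kernel
  inv_val := by decide +kernel

theorem val_comm_matA_matT : (comm matA matT).val =
    !![1, 0, 1, 1, 1, 0, 0;
       0, 1, 0, 1, 0, 0, 0;
       0, 0, 1, 0, 1, 0, 0;
       0, 0, 0, 1, 0, 0, 0;
       0, 0, 0, 0, 1, 0, 0;
       0, 0, 0, 0, 0, 1, 0;
       0, 0, 0, 0, 0, 0, 1] :=
  val_comm rfl rfl (by decide +kernel)

theorem val_leftNormed_matA_matT_matA_matA :
    (leftNormed matA [matT, matA, matA]).val =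
      1 + single 1 5 1 + single 2 6 1 := by
  have h : (comm (comm matA matT) matA).val =
      1 + single 1 5 1 + single 2 5 1 := val_comm val_comm_matA_matT rfl (by decide +kernel)
  exact val_comm h rfl (by decide +kernel)

theorem leftNormed_matA_matT_matT : leftNormed matA [matT, matT] = 1 :=
  Units.ext (val_comm val_comm_matA_matT rfl (by decide +kernel))

theorem leftNormed_matA_matT_matA_matA_matA : leftNormed matA [matT, matA, matA, matA] = 1 :=
  Units.ext (val_comm val_leftNormed_matA_matT_matA_matA rfl (by decide +kernel))

theorem val_leftNormed_w :
    (leftNormed matA [matT, matA, matA, matT, matA]).val =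
      1 + single 0 6 1 := by
  have h : (leftNormed matA [matT, matA, matA, matT]).val =
      1 + single 0 5 1 := val_comm val_leftNormed_matA_matT_matA_matA rfl (by decide +kernel)
  exact val_comm h rfl (by decide +kernel)

/-- The homomorphism from `D` to invertible `7 × 7` matrices over `𝔽₂` with `a ↦ matA`,
`t ↦ matT`. -/
def rep : D →* (Matrix (Fin 7) (Fin 7) (ZMod 2))ˣ :=
  PresentedGroup.toGroup (f := ![matA, matT]) (by
    rintro r (rfl | rfl)
    · simpa [map_leftNormed] using leftNormed_matA_matT_matT
    · simpa [map_leftNormed] using leftNormed_matA_matT_matA_matA_matA)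

theorem rep_a : rep a = matA := PresentedGroup.toGroup.of _

theorem rep_t : rep t = matT := PresentedGroup.toGroup.of _

theorem range_rep_le : rep.range ≤ unitriangular (ZMod 2) 7 1 := by
  rw [MonoidHom.range_eq_map, ← PresentedGroup.closure_range_of relators, MonoidHom.map_closure,
    Subgroup.closure_le]
  rintro _ ⟨_, ⟨i, rfl⟩, rfl⟩
  fin_cases i
  · change rep a ∈ unitriangular (ZMod 2) 7 1
    rw [rep_a]
    exact mem_unitriangular_iff.2 (by decide +kernel)
  · change rep t ∈ unitriangular (ZMod 2) 7 1
    rw [rep_t]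
    exact mem_unitriangular_iff.2 (by decide +kernel)

theorem w_notMem_lcs : w ∉ lcs D 6 := by
  intro h
  have h := (map_lcs_le_unitriangular range_rep_le 6 (Subgroup.mem_map_of_mem rep h)).1
  -- an element of `unitriangular _ 7 7` is `1`, but the entry `(0, 6)` of the image of `w` is `1`
  have h := h 0 6 (by decide)
  rw [w, map_leftNormed] at h
  simp only [List.map, rep_a, rep_t] at h
  rw [val_leftNormed_w] at h
  simp at h

end Representation

/-! ### The generalized `2`-torsion element -/

theorem leftNormed_a_t_t : leftNormed a [t, t] = 1 := by
  have h := (PresentedGroup.one_of_mem (rels := relators) (Or.inl rfl))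
  rw [map_leftNormed] at h
  exact h

theorem leftNormed_a_t_a_a_a : leftNormed a [t, a, a, a] = 1 := by
  have h := (PresentedGroup.one_of_mem (rels := relators) (Or.inr rfl))
  rw [map_leftNormed] at h
  exact h

theorem w_sq_mem : w ^ 2 ∈ ⁅Subgroup.normalClosure {w}, (⊤ : Subgroup D)⁆ := by
  have hw := commute_mk_of_mem (Subgroup.subset_normalClosure (Set.mem_singleton w))
  rw [← QuotientGroup.eq_one_iff, QuotientGroup.mk_pow]
  set q := QuotientGroup.mk' ⁅Subgroup.normalClosure {w}, (⊤ : Subgroup D)⁆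
  have hq : leftNormed (q a) [q t, q a, q a, q t, q a] = q w :=
    (map_leftNormed q a [t, a, a, t, a]).symm
  change q w ^ 2 = 1
  rw [← hq]
  refine sq_eq_one_of_central ?_ ?_ ?_
  · simpa [leftNormed_a_t_t] using (map_leftNormed q a [t, t]).symm
  · simpa [leftNormed_a_t_a_a_a] using (map_leftNormed q a [t, a, a, a]).symm
  · rw [hq]
    exact (QuotientGroup.mk'_surjective _).forall.2 hw

/-- A torsion-free nilpotent quotient kills `w`, whose image there has finite order. -/
theorem not_isResiduallyTorsionFreeNilpotent : ¬ IsResiduallyTorsionFreeNilpotent D := by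
  intro h
  obtain ⟨N, hN, hwN, hnil, htf⟩ := h w fun h => w_notMem_lcs (h ▸ one_mem _)
  obtain ⟨n, hn⟩ := Subgroup.nilpotent_iff_lowerCentralSeries.1 hnil
  refine hwN ((QuotientGroup.eq_one_iff w).1 (htf _ ?_))
  refine isOfFinOrder_iff_pow_eq_one.2 ⟨2 ^ n, by positivity, ?_⟩
  have h := Subgroup.mem_map_of_mem (QuotientGroup.mk' N) (pow_pow_mem_lcs w_sq_mem n)
  rw [lcs, Subgroup.map_lowerCentralSeries,
    Subgroup.map_top_of_surjective _ (QuotientGroup.mk'_surjective N), hn] at h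
  simpa using h

theorem exists_orderOf_w_eq_two_pow (n : ℕ) :
    ∃ k : ℕ, orderOf (QuotientGroup.mk w : D ⧸ lcs D n) = 2 ^ k := by
  have hw : (QuotientGroup.mk w : D ⧸ lcs D n) ^ 2 ^ n = 1 :=
    (QuotientGroup.eq_one_iff _).2 (pow_pow_mem_lcs w_sq_mem n)
  obtain ⟨k, -, hk⟩ := (Nat.dvd_prime_pow Nat.prime_two).1 (orderOf_dvd_of_pow_eq_one hw)
  exact ⟨k, hk⟩

end TwoCommutators

theorem theorem7 :
    -- the group is not residually torsion-free nilpotent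
    ¬ TwoCommutators.IsResiduallyTorsionFreeNilpotent TwoCommutators.D ∧
    -- `w ∉ γ₇`
    TwoCommutators.w ∉ TwoCommutators.lcs TwoCommutators.D 6 ∧
    -- `w² ∈ [⟨w⟩^D, D] γₙ₊₁` for all `n ≥ 0`
    (∀ n : ℕ, TwoCommutators.w ^ 2 ∈
      ⁅Subgroup.normalClosure {TwoCommutators.w}, (⊤ : Subgroup TwoCommutators.D)⁆ ⊔
        TwoCommutators.lcs TwoCommutators.D n) ∧
    -- the order of `w` modulo `γₙ₊₁` is a power of `2` for all `n ≥ 0`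
    (∀ n : ℕ, ∃ k : ℕ,
      orderOf (QuotientGroup.mk TwoCommutators.w :
        TwoCommutators.D ⧸ TwoCommutators.lcs TwoCommutators.D n) = 2 ^ k) :=
  ⟨TwoCommutators.not_isResiduallyTorsionFreeNilpotent, TwoCommutators.w_notMem_lcs,
    fun _ => Subgroup.mem_sup_left TwoCommutators.w_sq_mem,
    TwoCommutators.exists_orderOf_w_eq_two_pow⟩
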